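/- Let $m,n\ge 1$ be integers, $d=\gcd(m,n)$, $m=ad$, $n=bd$, $\xi=e^{2\pi i/d}$, and let $G=\langle x,y\mid x^m=y^n\rangle$. Let $Y\subset\mathbb{C}^G$ be the set of characters $\chi_\rho(g)=\operatorname{tr}\rho(g)$ of the homomorphisms $\rho:G\to SU(2)$, with the topology induced by the product topology (pointwise convergence) of $\mathbb{C}^G$. For $0\le j\le \lfloor d/2\rfloor$ let $Y_{red}^{j}\subset Y$ be the set of characters of the reducible representations $\rho:G\to SU(2)$ that have a common eigenvector $v$, with $\rho(x)v=\lambda v$ and $\rho(y)v=\mu v$, such that $\lambda^a=\xi^j\mu^b$. For integers $0<k<m$, $0<k'<n$ with $k\equiv k' \pmod 2$ let $Y_{irr}^{(k,k')}\subset Y$ be the set of characters of the irreducible representations $\rho:G\to SU(2)$ such that $e^{\pi i k/m}$ is an eigenvalue of $\rho(x)$ and $e^{\pi i k'/n}$ is an eigenvalue of $\rho(y)$. Then for any two different indices $i_0,i_1\in\{0,\dots,\lfloor d/2\rfloor\}$ there is a pair $(k,k')$ with $0<k<m$, $0<k'<n$, $k\equiv k'\pmod 2$ such that $\overline{Y}_{irr}^{(k,k')}$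 joins $Y_{red}^{i_0}$ and $Y_{red}^{i_1}$: this closure is homeomorphic to $[0,1]$, its interior points (those corresponding to $(0,1)$) form $Y_{irr}^{(k,k')}$, one endpoint lies in $Y_{red}^{i_0}$ and the other in $Y_{red}^{i_1}$. Explicitly, if $i_0<i_1$, one can take $k=d+i_0-i_1$ and $k'=d-i_0-i_1$. In particular, $Y$ is connected. -/

import Mathlib

open Set

noncomputable section

namespace TorusChar

/-- The group `SU(2)`. -/
abbrev SU2 : Type := Matrix.specialUnitaryGroup (Fin 2) ℂ

/-- The group `G = ⟨x, y ∣ x ^ m = y ^ n⟩`; the generator `0` is `x`, the generator `1` is `y`. -/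
abbrev TorusGroup (m n : ℕ) : Type :=
  PresentedGroup
    ({FreeGroup.of 0 ^ m * (FreeGroup.of 1 ^ n)⁻¹} : Set (FreeGroup (Fin 2)))

/-- The generator `x` of `G`. -/
def genX (m n : ℕ) : TorusGroup m n := PresentedGroup.of 0

/-- The generator `y` of `G`. -/
def genY (m n : ℕ) : TorusGroup m n := PresentedGroup.of 1

variable {G : Type*} [Group G]

/-- The representation on `ℂ²` given by a homomorphism `ρ : G → SU(2)`. -/
def toRep (ρ : G →* SU2) : Representation ℂ G (Fin 2 → ℂ) where
  toFun g := Matrix.toLin' (ρ g : Matrix (Fin 2) (Fin 2) ℂ)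
  map_one' := by simp [Module.End.one_eq_id]
  map_mul' g h := by simp [Matrix.toLin'_mul, Module.End.mul_eq_comp]

/-- The character `g ↦ tr (ρ g)`. -/
def chi (ρ : G →* SU2) : G → ℂ := fun g => Matrix.trace (ρ g : Matrix (Fin 2) (Fin 2) ℂ)

/-- The set `Y` of characters of `SU(2)`-representations of `G = ⟨x, y ∣ x ^ m = y ^ n⟩`.
It is a subset of `G → ℂ`, which carries the topology of pointwise convergence. -/
def Y (m n : ℕ) : Set (TorusGroup m n → ℂ) :=
  {χ | ∃ ρ : TorusGroup m n →* SU2, χ = chi ρ}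

/-- `Y_red^i`: the characters of the reducible `SU(2)`-representations with a common eigenvector
`v`, `ρ(x) v = l v` and `ρ(y) v = u v`, such that `l ^ a = ξ ^ i * u ^ b`, where
`d = gcd(m, n)`, `a = m / d`, `b = n / d` and `ξ = exp(2πi/d)`. -/
def Yred (m n i : ℕ) : Set (TorusGroup m n → ℂ) :=
  {χ | ∃ ρ : TorusGroup m n →* SU2, χ = chi ρ ∧ ¬ (toRep ρ).IsIrreducible ∧
    ∃ (v : Fin 2 → ℂ) (l u : ℂ), v ≠ 0 ∧
      toRep ρ (genX m n) v = l • v ∧ toRep ρ (genY m n) v = u • v ∧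
      l ^ (m / m.gcd n) =
        Complex.exp (2 * Real.pi * Complex.I / (m.gcd n : ℂ)) ^ i * u ^ (n / m.gcd n)}

/-- `Y_irr^(k,k')`: the characters of the irreducible `SU(2)`-representations for which
`exp(πik/m)` is an eigenvalue of `ρ(x)` and `exp(πik'/n)` is an eigenvalue of `ρ(y)`. -/
def Yirr (m n k k' : ℕ) : Set (TorusGroup m n → ℂ) :=
  {χ | ∃ ρ : TorusGroup m n →* SU2, χ = chi ρ ∧ (toRep ρ).IsIrreducible ∧
    Module.End.HasEigenvalue (toRep ρ (genX m n)) (Complex.exp (Real.pi * Complex.I * k / m)) ∧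
    Module.End.HasEigenvalue (toRep ρ (genY m n)) (Complex.exp (Real.pi * Complex.I * k' / n))}

/-- The pairs `(k, k')` that index the pieces `Y_irr^(k,k')` of `Y_irr`. -/
def IsIndexPair (m n k k' : ℕ) : Prop :=
  0 < k ∧ k < m ∧ 0 < k' ∧ k' < n ∧ k ≡ k' [MOD 2]

/-- The closure of `S` is an arc (a homeomorphic image of `[0, 1]`) whose interior is `S` and
which has one endpoint in `A` and the other one in `B`. -/
def ClosureJoins {X : Type*} [TopologicalSpace X] (S A B : Set X) : Prop :=
  ∃ γ : unitInterval → X, Topology.IsEmbedding γ ∧ range γ = closure S ∧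
    γ '' Ioo 0 1 = S ∧ γ 0 ∈ A ∧ γ 1 ∈ B

end TorusChar

end

noncomputable section

open Matrix Complex ComplexConjugate

namespace TorusChar

/-! Up to conjugation a pair in `SU(2)` is a diagonal matrix of angle α and a rotation of angle β
about an axis at angle φ to the first, with α, β, φ in [0, π] (`exists_conj_pair`). For α = πk/m and
β = πk'/n with k ≡ k' mod 2, both x^m and y^n equal the sign (-1)^k, so φ is free and gives an arc
of characters. The trace of xy is affine in cos φ with nonzero slope, so the arc is embedded
(`characterArc_injective`). The pair is irreducible exactly when sin φ ≠ 0, so the open arc is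
`Yirr` (`characterArc_image_Ioo`), and compactness makes the closed arc its closure.

At φ = 0 both matrices are diagonal and λ^a / μ^b = exp(πi(k - k')/d); at φ = π the sign of β flips
and the quotient is exp(πi(k + k')/d). With k = d + i₀ - i₁ and k' = d - i₀ - i₁ these are ξ^i₀ and
ξ^(-i₁), and passing to the other eigenvector inverts the latter.

Connectedness is proved separately, by a path in `Y` from any character to the trivial one
(`joinedIn_Y_one`). -/

/-! ### Coordinates on `SU(2)` -/

/-- The element of `SU(2)` with first column `(p, q)`. -/
def ofColumn (p q : ℂ) (h : normSq p + normSq q = 1) : SU2 :=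
  ⟨!![p, -conj q; q, conj p], by
    have h' : p * conj p + q * conj q = 1 := by
      rw [mul_conj, mul_conj]; exact_mod_cast h
    rw [mem_specialUnitaryGroup_iff, mem_unitaryGroup_iff]
    constructor
    · ext i j
      fin_cases i <;> fin_cases j <;> simp [Matrix.mul_apply, star_eq_conjTranspose] <;>
        first | linear_combination h' | ring
    · rw [det_fin_two_of]; linear_combination h'⟩

/-- The conjugate transpose and the adjugate are both the inverse of `A`; comparing entries
determines the second column. -/
theorem eq_ofColumn (A : SU2) :
    ∃ h, A = ofColumn (A.1 0 0) (A.1 1 0) h := by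
  obtain ⟨A, hA⟩ := A
  obtain ⟨hu, hd⟩ := mem_specialUnitaryGroup_iff.1 hA
  have hs : star A = adjugate A := by
    calc star A = star A * (A * adjugate A) := by rw [mul_adjugate, hd, one_smul, mul_one]
      _ = adjugate A := by rw [← mul_assoc, mem_unitaryGroup_iff'.1 hu, one_mul]
  rw [adjugate_fin_two, star_eq_conjTranspose] at hs
  have h11 : conj (A 0 0) = A 1 1 := by simpa using congrFun (congrFun hs 0) 0
  have h10 : conj (A 1 0) = -A 0 1 := by simpa using congrFun (congrFun hs 0) 1
  refine ⟨?_, ?_⟩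
  · rw [det_fin_two] at hd
    rw [← ofReal_inj]
    push_cast
    rw [← mul_conj, ← mul_conj, h11, h10]
    linear_combination hd
  · apply Subtype.ext
    ext i j
    fin_cases i <;> fin_cases j <;> simp [ofColumn, h11, h10]

theorem ext_column {A B : SU2} (h0 : A.1 0 0 = B.1 0 0) (h1 : A.1 1 0 = B.1 1 0) : A = B := by
  obtain ⟨hA, eA⟩ := eq_ofColumn A
  obtain ⟨hB, eB⟩ := eq_ofColumn B
  rw [eA, eB]
  simp only [h0, h1]

/-- The rotation `cos α + i sin α N`, where `N` is the reflection with direction `φ`. -/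
def rotation (α φ : ℝ) : SU2 :=
  ofColumn (Real.cos α + I * (Real.sin α * Real.cos φ)) (I * (Real.sin α * Real.sin φ)) (by
    have h1 := Real.sin_sq_add_cos_sq α
    have h2 := Real.sin_sq_add_cos_sq φ
    simp only [normSq_apply, ← ofReal_mul]
    simp only [add_re, add_im, mul_re, mul_im, I_re, I_im, ofReal_re, ofReal_im]
    linear_combination h1 + Real.sin α ^ 2 * h2)

theorem rotation_val (α φ : ℝ) : (rotation α φ).1 =
    !![Real.cos α + I * (Real.sin α * Real.cos φ), I * (Real.sin α * Real.sin φ);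
      I * (Real.sin α * Real.sin φ), Real.cos α - I * (Real.sin α * Real.cos φ)] := by
  ext i j
  fin_cases i <;> fin_cases j <;>
    simp [rotation, ofColumn, conj_ofReal, -ofReal_cos, -ofReal_sin, sub_eq_add_neg]

theorem continuous_rotation : Continuous fun p : ℝ × ℝ => rotation p.1 p.2 := by
  refine Continuous.subtype_mk (continuous_matrix fun i j => ?_) _
  fin_cases i <;> fin_cases j <;> simp [-ofReal_cos, -ofReal_sin] <;> fun_prop

/-- The reflection N squares to 1, so `rotation α φ` is exp(iαN) and angles about a common axis add.
-/
theorem rotation_mul (α β φ : ℝ) : rotation α φ * rotation β φ = rotation (α + β) φ := by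
  have h2 : (Real.sin φ : ℂ) ^ 2 + (Real.cos φ : ℂ) ^ 2 = 1 := by
    exact_mod_cast Real.sin_sq_add_cos_sq φ
  apply ext_column <;>
  · rw [Submonoid.coe_mul]
    simp only [rotation_val, Real.cos_add, Real.sin_add]
    push_cast
    push_cast at h2
    simp [Matrix.mul_apply]
    ring_nf
    try simp only [I_sq]
    try linear_combination (-(Complex.sin α * Complex.sin β)) * h2

theorem rotation_zero (φ : ℝ) : rotation 0 φ = 1 := by
  apply ext_column <;> simp [rotation_val]

theorem rotation_pow (α φ : ℝ) (n : ℕ) : rotation α φ ^ n = rotation (n * α) φ := by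
  induction n with
  | zero => simp [rotation_zero]
  | succ n ih => rw [pow_succ, ih, rotation_mul]; congr 1; push_cast; ring

theorem rotation_eq_of_sin_eq_zero {α : ℝ} (h : Real.sin α = 0) (φ ψ : ℝ) :
    rotation α φ = rotation α ψ := by
  apply ext_column <;> simp only [rotation_val, h] <;> simp

/-- Direction π replaces N by -N. This identifies the far end of each arc as a diagonal pair. -/
theorem rotation_pi (α : ℝ) : rotation α Real.pi = rotation (-α) 0 := by
  apply ext_column <;> simp [rotation_val]

theorem rotation_add_two_pi (α φ : ℝ) (N : ℤ) :
    rotation (α + N * (2 * Real.pi)) φ = rotation α φ := by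
  apply ext_column <;> simp only [rotation_val, Real.cos_add_int_mul_two_pi,
    Real.sin_add_int_mul_two_pi]

theorem rotation_zero_right_val (α : ℝ) :
    (rotation α 0).1 = !![exp (α * I), 0; 0, exp (-(α * I))] := by
  rw [rotation_val, exp_mul_I, ← neg_mul, exp_mul_I]
  simp [mul_comm, sub_eq_add_neg]

theorem trace_rotation (α φ : ℝ) : (rotation α φ).1.trace = 2 * Real.cos α := by
  rw [rotation_val, trace_fin_two_of]; ring

theorem trace_rotation_mul (α β φ : ℝ) : (rotation α 0 * rotation β φ).1.trace =
    2 * (Real.cos α * Real.cos β - Real.sin α * Real.sin β * Real.cos φ) := by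
  rw [Submonoid.coe_mul, rotation_val, rotation_val, mul_fin_two, trace_fin_two_of]
  simp only [Real.cos_zero, Real.sin_zero, ofReal_zero, ofReal_one]
  linear_combination (2 * Real.sin α * Real.sin β * Real.cos φ) * I_sq

/-! ### Normal form of a pair under conjugation -/

theorem exists_eigenvector (A : SU2) : ∃ (l : ℂ) (v : Fin 2 → ℂ), v ≠ 0 ∧ A.1 *ᵥ v = l • v := by
  obtain ⟨l, hl⟩ := Module.End.exists_eigenvalue (Matrix.toLin' A.1)
  obtain ⟨v, hv⟩ := hl.exists_hasEigenvector
  exact ⟨l, v, hv.2, by simpa using hv.apply_eq_smul⟩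

theorem exists_column (v : Fin 2 → ℂ) (hv : v ≠ 0) :
    ∃ (P : SU2) (c : ℂ), c ≠ 0 ∧ P.1 *ᵥ ![1, 0] = c • v := by
  have hpos : 0 < normSq (v 0) + normSq (v 1) := by
    rcases eq_or_ne (v 0) 0 with h | h
    · have : v 1 ≠ 0 := fun h' => hv (by ext i; fin_cases i <;> assumption)
      have := normSq_pos.2 this
      have := normSq_nonneg (v 0)
      linarith
    · have := normSq_pos.2 h
      have := normSq_nonneg (v 1)
      linarith
  set r := Real.sqrt (normSq (v 0) + normSq (v 1))
  have hr : 0 < r := Real.sqrt_pos.2 hpos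
  have hr2 : r * r = normSq (v 0) + normSq (v 1) := Real.mul_self_sqrt hpos.le
  refine ⟨ofColumn ((r⁻¹ : ℝ) * v 0) ((r⁻¹ : ℝ) * v 1) ?_, (r⁻¹ : ℝ), ?_, ?_⟩
  · rw [normSq_mul, normSq_mul, normSq_ofReal, ← mul_add, ← hr2]
    field_simp
  · exact_mod_cast (inv_pos.2 hr).ne'
  · ext i
    fin_cases i <;> simp [ofColumn, mulVec, dotProduct]

/-- A common eigenvector with eigenvalue `l` turns into the first basis vector. -/
theorem exists_conj_column (v : Fin 2 → ℂ) (hv : v ≠ 0) : ∃ P : SU2,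
    ∀ (A : SU2) (l : ℂ), A.1 *ᵥ v = l • v →
      (P * A * P⁻¹).1 0 0 = l ∧ (P * A * P⁻¹).1 1 0 = 0 := by
  obtain ⟨P, c, hc, hP⟩ := exists_column v hv
  refine ⟨P⁻¹, fun A l h => ?_⟩
  have key : (P⁻¹ * A * P⁻¹⁻¹).1 *ᵥ ![1, 0] = l • ![1, 0] := by
    rw [inv_inv, Submonoid.coe_mul, Submonoid.coe_mul, ← mulVec_mulVec, hP, mulVec_smul,
      ← mulVec_mulVec, h, mulVec_smul, smul_comm, ← mulVec_smul, ← hP, mulVec_mulVec,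
      ← Submonoid.coe_mul, inv_mul_cancel]
    simp
  constructor
  · simpa [mulVec, dotProduct] using congrFun key 0
  · simpa [mulVec, dotProduct] using congrFun key 1

theorem eq_rotation_of_diagonal {A : SU2} (h : A.1 1 0 = 0) :
    A = rotation (arg (A.1 0 0)) 0 := by
  obtain ⟨h1, -⟩ := eq_ofColumn A
  rw [h, map_zero, add_zero, normSq_eq_norm_sq] at h1
  have hn : ‖A.1 0 0‖ = 1 := by
    nlinarith [norm_nonneg (A.1 0 0)]
  apply ext_column
  · rw [rotation_zero_right_val]
    have := norm_mul_exp_arg_mul_I (A.1 0 0)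
    rw [hn] at this
    simpa using this.symm
  · rw [h, rotation_zero_right_val]; simp

/-- The Weyl element swaps the two coordinate axes, hence the two eigenvalues. -/
theorem exists_conj_neg :
    ∃ J : SU2, ∀ α : ℝ, J * rotation α 0 * J⁻¹ = rotation (-α) 0 := by
  refine ⟨ofColumn 0 1 (by simp), fun α => ?_⟩
  rw [mul_inv_eq_iff_eq_mul]
  apply ext_column <;> rw [Submonoid.coe_mul, Submonoid.coe_mul] <;>
    simp [rotation_zero_right_val, ofColumn, Matrix.mul_apply]

theorem exists_conj_rotation (A : SU2) :
    ∃ (P : SU2) (α : ℝ), α ∈ Icc 0 Real.pi ∧ P * A * P⁻¹ = rotation α 0 := by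
  obtain ⟨l, v, hv, h⟩ := exists_eigenvector A
  obtain ⟨P, hP⟩ := exists_conj_column v hv
  obtain ⟨h0, h1⟩ := hP A l h
  have e := eq_rotation_of_diagonal h1
  rw [h0] at e
  rcases le_total 0 (arg l) with h' | h'
  · exact ⟨P, arg l, ⟨h', arg_le_pi l⟩, e⟩
  · obtain ⟨J, hJ⟩ := exists_conj_neg
    refine ⟨J * P, -arg l, ⟨by linarith, by linarith [neg_pi_lt_arg l]⟩, ?_⟩
    rw [← hJ (arg l), ← e]; group

theorem exists_diagonal_conj_rotation (B : SU2) : ∃ θ β φ : ℝ, β ∈ Icc 0 Real.pi ∧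
    φ ∈ Icc 0 Real.pi ∧ rotation θ 0 * B * (rotation θ 0)⁻¹ = rotation β φ := by
  obtain ⟨hB, eB⟩ := eq_ofColumn B
  set p := B.1 0 0
  set q := B.1 1 0
  -- Spherical coordinates: cos β = Re p, sin β cos φ = Im p and sin β sin φ = |q|. The angles are
  -- the arguments of `w` and `z`, which lie in the closed upper half plane.
  set z : ℂ := ⟨p.im, ‖q‖⟩ with hz
  set w : ℂ := ⟨p.re, ‖z‖⟩ with hw
  have hz2 : ‖z‖ ^ 2 = p.im ^ 2 + ‖q‖ ^ 2 := by
    rw [← normSq_eq_norm_sq, normSq_apply]; simp only [hz]; ring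
  have hw2 : ‖w‖ ^ 2 = 1 := by
    rw [← normSq_eq_norm_sq, normSq_apply, ← hB]
    simp only [hw]
    rw [normSq_apply p, normSq_eq_norm_sq q]
    linear_combination hz2
  have hw1 : ‖w‖ = 1 := by nlinarith [norm_nonneg w]
  have c1 : Real.cos (arg w) = p.re := by
    have := norm_mul_cos_arg w
    rwa [hw1, one_mul] at this
  have s1 : Real.sin (arg w) = ‖z‖ := by
    have := norm_mul_sin_arg w
    rwa [hw1, one_mul] at this
  have c2 : ‖z‖ * Real.cos (arg z) = p.im := norm_mul_cos_arg z
  have s2 : ‖z‖ * Real.sin (arg z) = ‖q‖ := norm_mul_sin_arg z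
  -- Conjugation by diag(e^{iθ}, e^{-iθ}) fixes p and multiplies q by e^{-2iθ}; this θ turns q into
  -- i|q|.
  refine ⟨(arg q - Real.pi / 2) / 2, arg w, arg z,
    ⟨arg_nonneg_iff.2 (norm_nonneg z), arg_le_pi w⟩,
    ⟨arg_nonneg_iff.2 (norm_nonneg q), arg_le_pi z⟩, ?_⟩
  rw [mul_inv_eq_iff_eq_mul]
  have hp : (p.re : ℂ) + I * p.im = p := by rw [mul_comm]; exact re_add_im p
  apply ext_column <;> rw [Submonoid.coe_mul, Submonoid.coe_mul, rotation_zero_right_val]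
  · simp only [rotation_val, Matrix.mul_apply, Fin.sum_univ_two]
    rw [s1, c1, ← ofReal_mul, c2, hp]
    simp [mul_comm, p]
  · simp only [rotation_val, Matrix.mul_apply, Fin.sum_univ_two]
    rw [s1, c1, ← ofReal_mul, ← ofReal_mul, s2]
    have hq : q = ‖q‖ * exp (arg q * I) := (norm_mul_exp_arg_mul_I q).symm
    have : exp (arg q * I) * exp (-(((arg q - Real.pi / 2) / 2 : ℝ) * I)) =
        I * exp (((arg q - Real.pi / 2) / 2 : ℝ) * I) := by
      calc _ = exp (Real.pi / 2 * I) * exp (((arg q - Real.pi / 2) / 2 : ℝ) * I) := by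
            rw [← exp_add, ← exp_add]; congr 1; push_cast; ring
        _ = _ := by rw [exp_pi_div_two_mul_I]
    simp
    change _ * q = _
    push_cast at this
    linear_combination (‖q‖ : ℂ) * this + exp (-((arg q - Real.pi / 2) / 2 * I)) * hq

/-- Up to simultaneous conjugation a pair in `SU(2)` consists of a diagonal matrix and a rotation
about an axis in a fixed plane. -/
theorem exists_conj_pair (A B : SU2) : ∃ (P : SU2) (α β φ : ℝ), α ∈ Icc 0 Real.pi ∧
    β ∈ Icc 0 Real.pi ∧ φ ∈ Icc 0 Real.pi ∧
    P * A * P⁻¹ = rotation α 0 ∧ P * B * P⁻¹ = rotation β φ := by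
  obtain ⟨P, α, hα, hA⟩ := exists_conj_rotation A
  obtain ⟨θ, β, φ, hβ, hφ, hB⟩ := exists_diagonal_conj_rotation (P * B * P⁻¹)
  refine ⟨rotation θ 0 * P, α, β, φ, hα, hβ, hφ, ?_, ?_⟩
  · calc _ = rotation θ 0 * (P * A * P⁻¹) * (rotation θ 0)⁻¹ := by group
      _ = rotation α 0 := by
        rw [hA, mul_inv_eq_iff_eq_mul, rotation_mul, rotation_mul, add_comm]
  · rw [← hB]; group

/-! ### Homomorphisms from the torus group and irreducibility -/

variable {m n : ℕ}

theorem genX_pow_eq_genY_pow : genX m n ^ m = genY m n ^ n := by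
  have h : PresentedGroup.mk
      ({FreeGroup.of 0 ^ m * (FreeGroup.of 1 ^ n)⁻¹} : Set (FreeGroup (Fin 2)))
      (FreeGroup.of 0 ^ m * (FreeGroup.of 1 ^ n)⁻¹) = 1 :=
    PresentedGroup.one_of_mem rfl
  rw [map_mul, map_inv, map_pow, map_pow, mul_inv_eq_one] at h
  exact h

/-- The homomorphism given by a pair of matrices. -/
def homOfPair (A B : SU2) (h : A ^ m = B ^ n) : TorusGroup m n →* SU2 :=
  PresentedGroup.toGroup (f := ![A, B]) (by
    rintro r rfl
    simp [h])

theorem homOfPair_genX (A B : SU2) (h : A ^ m = B ^ n) : homOfPair A B h (genX m n) = A :=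
  PresentedGroup.toGroup.of _

theorem homOfPair_genY (A B : SU2) (h : A ^ m = B ^ n) : homOfPair A B h (genY m n) = B :=
  PresentedGroup.toGroup.of _

theorem hom_eq_homOfPair (ρ : TorusGroup m n →* SU2) (A B : SU2) (h : A ^ m = B ^ n)
    (hA : ρ (genX m n) = A) (hB : ρ (genY m n) = B) : ρ = homOfPair A B h := by
  refine PresentedGroup.ext fun i => ?_
  fin_cases i
  · exact hA.trans (homOfPair_genX A B h).symm
  · exact hB.trans (homOfPair_genY A B h).symm

theorem mem_of_genX_mem_of_genY_mem {H : Subgroup (TorusGroup m n)} (hx : genX m n ∈ H)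
    (hy : genY m n ∈ H) (g : TorusGroup m n) : g ∈ H := by
  refine PresentedGroup.generated_by _ H (fun i => ?_) g
  fin_cases i
  · exact hx
  · exact hy

/-- The elements at which evaluation is continuous form a subgroup, and it contains both generators.
-/
theorem continuous_homOfPair_apply {T : Type*} [TopologicalSpace T] {A B : T → SU2}
    (hA : Continuous A) (hB : Continuous B) (h : ∀ t, A t ^ m = B t ^ n) (g : TorusGroup m n) :
    Continuous fun t => homOfPair (A t) (B t) (h t) g := by
  let H : Subgroup (TorusGroup m n) :=
    { carrier := {g | Continuous fun t => homOfPair (A t) (B t) (h t) g}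
      one_mem' := by simpa using continuous_const
      mul_mem' := fun {a b} ha hb => by
        change Continuous fun t => homOfPair (A t) (B t) (h t) (a * b)
        simp only [map_mul]
        exact Continuous.mul ha hb
      inv_mem' := fun {a} ha => by
        change Continuous fun t => homOfPair (A t) (B t) (h t) a⁻¹
        simp only [map_inv]
        exact Continuous.subtype_mk (continuous_subtype_val.comp ha).star _ }
  refine mem_of_genX_mem_of_genY_mem (H := H) ?_ ?_ g
  · change Continuous _
    simpa only [homOfPair_genX] using hA
  · change Continuous _
    simpa only [homOfPair_genY] using hB

theorem continuous_chi_homOfPair {T : Type*} [TopologicalSpace T] {A B : T → SU2}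
    (hA : Continuous A) (hB : Continuous B) (h : ∀ t, A t ^ m = B t ^ n) :
    Continuous fun t => chi (homOfPair (A t) (B t) (h t)) :=
  continuous_pi fun g =>
    (continuous_subtype_val.comp (continuous_homOfPair_apply hA hB h g)).matrix_trace

theorem chi_conj {G : Type*} [Group G] (ρ : G →* SU2) (P : SU2) :
    chi ((MulAut.conj P).toMonoidHom.comp ρ) = chi ρ := by
  funext g
  change (P * ρ g * P⁻¹).1.trace = (ρ g).1.trace
  rw [Submonoid.coe_mul, trace_mul_comm, ← Submonoid.coe_mul]
  congr 2
  group

theorem toRep_apply {G : Type*} [Group G] (ρ : G →* SU2) (g : G) (v : Fin 2 → ℂ) :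
    toRep ρ g v = (ρ g).1 *ᵥ v := rfl

theorem not_isIrreducible_of_common_eigenvector {G : Type*} [Group G] (ρ : G →* SU2)
    {v : Fin 2 → ℂ} (hv : v ≠ 0) (h : ∀ g, ∃ c : ℂ, toRep ρ g v = c • v) :
    ¬ (toRep ρ).IsIrreducible := by
  intro hi
  let S : Subrepresentation (toRep ρ) :=
    { toSubmodule := ℂ ∙ v
      apply_mem_toSubmodule := fun g w hw => by
        obtain ⟨a, rfl⟩ := Submodule.mem_span_singleton.1 hw
        obtain ⟨c, hc⟩ := h g
        rw [map_smul, hc]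
        exact Submodule.smul_mem _ _ (Submodule.smul_mem _ _ (Submodule.mem_span_singleton_self v)) }
  rcases hi.eq_bot_or_eq_top S with hS | hS
  · have h1 : (ℂ ∙ v) = (⊥ : Submodule ℂ (Fin 2 → ℂ)) :=
      congrArg Subrepresentation.toSubmodule hS
    exact hv (Submodule.span_singleton_eq_bot.1 h1)
  · have h1 : (ℂ ∙ v) = (⊤ : Submodule ℂ (Fin 2 → ℂ)) :=
      congrArg Subrepresentation.toSubmodule hS
    have h2 := finrank_span_singleton (K := ℂ) hv
    rw [h1, finrank_top] at h2
    simp at h2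

/-- In dimension 2 a proper nonzero invariant subspace is a line, spanned by a common eigenvector.
-/
theorem isIrreducible_of_no_common_eigenvector {G : Type*} [Group G] (ρ : G →* SU2)
    (h : ∀ v : Fin 2 → ℂ, (∀ g, ∃ c : ℂ, toRep ρ g v = c • v) → v = 0) :
    (toRep ρ).IsIrreducible := by
  have hne : (⊥ : Subrepresentation (toRep ρ)) ≠ ⊤ := fun hbt => by
    have : (⊥ : Submodule ℂ (Fin 2 → ℂ)) = ⊤ := congrArg Subrepresentation.toSubmodule hbt
    exact bot_ne_top this
  have : Nontrivial (Subrepresentation (toRep ρ)) := ⟨⟨_, _, hne⟩⟩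
  refine ⟨fun S => ?_⟩
  have hle : Module.finrank ℂ S.toSubmodule ≤ 2 := by
    simpa using Submodule.finrank_le S.toSubmodule
  interval_cases hd : Module.finrank ℂ S.toSubmodule
  · exact Or.inl (Subrepresentation.toSubmodule_injective (Submodule.finrank_eq_zero.1 hd))
  · exfalso
    obtain ⟨⟨v, hvS⟩, hv, hspan⟩ := finrank_eq_one_iff'.1 hd
    refine hv (Subtype.ext (h v fun g => ?_))
    obtain ⟨c, hc⟩ := hspan ⟨_, S.apply_mem_toSubmodule g hvS⟩
    exact ⟨c, (congrArg Subtype.val hc).symm⟩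
  · exact Or.inr (Subrepresentation.toSubmodule_injective
      (Submodule.eq_top_of_finrank_eq (by simpa using hd)))

theorem exists_eigenvalue_of_generators (ρ : TorusGroup m n →* SU2) {v : Fin 2 → ℂ}
    {l u : ℂ} (hx : toRep ρ (genX m n) v = l • v) (hy : toRep ρ (genY m n) v = u • v)
    (g : TorusGroup m n) : ∃ c : ℂ, toRep ρ g v = c • v := by
  rcases eq_or_ne v 0 with rfl | hv
  · exact ⟨0, by simp⟩
  let H : Subgroup (TorusGroup m n) :=
    { carrier := {g | ∃ c : ℂ, toRep ρ g v = c • v}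
      one_mem' := ⟨1, by simp⟩
      mul_mem' := by
        rintro a b ⟨c, hc⟩ ⟨c', hc'⟩
        exact ⟨c' * c, by rw [map_mul, Module.End.mul_apply, hc', map_smul, hc, smul_smul]⟩
      inv_mem' := by
        rintro a ⟨c, hc⟩
        have h1 : toRep ρ a⁻¹ (toRep ρ a v) = v := by
          rw [← Module.End.mul_apply, ← map_mul, inv_mul_cancel, map_one, Module.End.one_apply]
        rw [hc, map_smul] at h1
        have hc0 : c ≠ 0 := by
          rintro rfl
          exact hv (by rw [← h1, zero_smul])
        exact ⟨c⁻¹, by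
          rw [← inv_smul_smul₀ hc0 (toRep ρ a⁻¹ v), h1]⟩ }
  exact mem_of_genX_mem_of_genY_mem (H := H) ⟨l, hx⟩ ⟨u, hy⟩ g

theorem isIrreducible_toRep_iff (ρ : TorusGroup m n →* SU2) :
    (toRep ρ).IsIrreducible ↔ ∀ (v : Fin 2 → ℂ) (l u : ℂ),
      toRep ρ (genX m n) v = l • v → toRep ρ (genY m n) v = u • v → v = 0 := by
  constructor
  · intro hi v l u hx hy
    by_contra hv
    exact not_isIrreducible_of_common_eigenvector ρ hv
      (exists_eigenvalue_of_generators ρ hx hy) hi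
  · intro h
    refine isIrreducible_of_no_common_eigenvector ρ fun v hv => ?_
    obtain ⟨l, hl⟩ := hv (genX m n)
    obtain ⟨u, hu⟩ := hv (genY m n)
    exact h v l u hl hu

theorem isIrreducible_conj (ρ : TorusGroup m n →* SU2) (P : SU2)
    (h : (toRep ρ).IsIrreducible) :
    (toRep ((MulAut.conj P).toMonoidHom.comp ρ)).IsIrreducible := by
  rw [isIrreducible_toRep_iff] at h ⊢
  have key : ∀ (g : TorusGroup m n) (v : Fin 2 → ℂ) (c : ℂ),
      toRep ((MulAut.conj P).toMonoidHom.comp ρ) g v = c • v →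
      toRep ρ g (P⁻¹.1 *ᵥ v) = c • (P⁻¹.1 *ᵥ v) := by
    intro g v c hc
    have hc' : (P * ρ g * P⁻¹).1 *ᵥ v = c • v := hc
    rw [← mulVec_smul, ← hc', toRep_apply, mulVec_mulVec, mulVec_mulVec, ← Submonoid.coe_mul,
      ← Submonoid.coe_mul]
    congr 2
    group
  intro v l u hx hy
  have h0 := h _ l u (key _ _ _ hx) (key _ _ _ hy)
  have h1 : P.1 *ᵥ (P⁻¹.1 *ᵥ v) = v := by
    rw [mulVec_mulVec, ← Submonoid.coe_mul, mul_inv_cancel]; simp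
  rw [← h1, h0, mulVec_zero]

theorem exists_chi_eq_rotation (ρ : TorusGroup m n →* SU2) :
    ∃ (α β φ : ℝ) (h : rotation α 0 ^ m = rotation β φ ^ n), α ∈ Icc 0 Real.pi ∧
      β ∈ Icc 0 Real.pi ∧ φ ∈ Icc 0 Real.pi ∧
      chi ρ = chi (homOfPair (rotation α 0) (rotation β φ) h) ∧
      ((toRep ρ).IsIrreducible →
        (toRep (homOfPair (rotation α 0) (rotation β φ) h)).IsIrreducible) := by
  obtain ⟨P, α, β, φ, hα, hβ, hφ, hA, hB⟩ := exists_conj_pair (ρ (genX m n)) (ρ (genY m n))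
  have h : rotation α 0 ^ m = rotation β φ ^ n := by
    rw [← hA, ← hB, conj_pow, conj_pow, ← map_pow, ← map_pow, genX_pow_eq_genY_pow]
  have e := hom_eq_homOfPair ((MulAut.conj P).toMonoidHom.comp ρ) _ _ h hA hB
  refine ⟨α, β, φ, h, hα, hβ, hφ, ?_, fun hi => ?_⟩
  · rw [← e, chi_conj]
  · rw [← e]; exact isIrreducible_conj ρ P hi

/-- Since sin α ≠ 0, the eigenvectors of x lie on the coordinate axes; y preserves one exactly when
its off-diagonal entry i sin β sin φ vanishes. -/
theorem isIrreducible_homOfPair_rotation_iff (α β φ : ℝ)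
    (h : rotation α 0 ^ m = rotation β φ ^ n) (hα : Real.sin α ≠ 0) (hβ : Real.sin β ≠ 0) :
    (toRep (homOfPair (rotation α 0) (rotation β φ) h)).IsIrreducible ↔ Real.sin φ ≠ 0 := by
  simp only [isIrreducible_toRep_iff, toRep_apply, homOfPair_genX, homOfPair_genY]
  constructor
  · intro hi hφ
    have := hi ![1, 0] (Real.cos α + I * (Real.sin α * Real.cos 0))
      (Real.cos β + I * (Real.sin β * Real.cos φ))
      (by rw [rotation_val]; ext i; fin_cases i <;> simp [mulVec, dotProduct])
      (by rw [rotation_val, hφ]; ext i; fin_cases i <;> simp [mulVec, dotProduct])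
    simpa using congrFun this 0
  · intro hφ v l u hx hy
    have hsα : (Real.sin α : ℂ) ≠ 0 := ofReal_ne_zero.2 hα
    have hs : I * (Real.sin β * Real.sin φ : ℂ) ≠ 0 :=
      mul_ne_zero I_ne_zero (mul_ne_zero (ofReal_ne_zero.2 hβ) (ofReal_ne_zero.2 hφ))
    rw [rotation_val] at hx hy
    have x0 := congrFun hx 0
    have x1 := congrFun hx 1
    have y0 := congrFun hy 0
    have y1 := congrFun hy 1
    simp only [mulVec, dotProduct, Fin.sum_univ_two, of_apply, cons_val_zero, cons_val_one,
      Real.cos_zero, Real.sin_zero, ofReal_one, ofReal_zero, Pi.smul_apply, smul_eq_mul,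
      mul_one, mul_zero, zero_mul, add_zero, zero_add] at x0 x1 y0 y1
    have hv : v 0 * v 1 = 0 := by
      have : (2 * I * Real.sin α) * (v 0 * v 1) = 0 := by
        -- Eliminates the eigenvalue `l` from the two coordinates of the equation for x.
        linear_combination v 1 * x0 - v 0 * x1
      exact (mul_eq_zero.1 this).resolve_left (by simp [-ofReal_sin, hsα])
    rcases mul_eq_zero.1 hv with h0 | h1
    · rw [h0, mul_zero, mul_zero, zero_add] at y0
      have h1 := (mul_eq_zero.1 y0).resolve_left hs
      ext i; fin_cases i <;> assumption
    · rw [h1, mul_zero, mul_zero, add_zero] at y1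
      have h0 := (mul_eq_zero.1 y1).resolve_left hs
      ext i; fin_cases i <;> assumption

/-- As det A = 1, the characteristic polynomial is X² - (tr A) X + 1, so a root determines the trace
and conversely. -/
theorem hasEigenvalue_exp_iff_trace (A : SU2) (α : ℝ) :
    Module.End.HasEigenvalue (Matrix.toLin' A.1) (exp (α * I)) ↔ A.1.trace = 2 * Real.cos α := by
  have hd : A.1.det = 1 := (mem_specialUnitaryGroup_iff.1 A.2).2
  have hc : (2 * Real.cos α : ℂ) = exp (α * I) + exp (-(α * I)) := by
    rw [← neg_mul, exp_mul_I, exp_mul_I]; push_cast; rw [Complex.cos_neg, Complex.sin_neg]; ring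
  have he : exp (α * I) * exp (-(α * I)) = 1 := by rw [← exp_add, add_neg_cancel, exp_zero]
  rw [Module.End.hasEigenvalue_iff_isRoot_charpoly, Matrix.charpoly_toLin', charpoly_fin_two, hd,
    hc]
  simp only [Polynomial.IsRoot, Polynomial.eval_add, Polynomial.eval_sub, Polynomial.eval_mul,
    Polynomial.eval_pow, Polynomial.eval_X, Polynomial.eval_C]
  constructor
  · intro h
    apply mul_left_cancel₀ (exp_ne_zero (α * I))
    linear_combination -h - he
  · intro h
    rw [h]
    linear_combination -he

/-! ### The arcs of characters -/

theorem rotation_pow_eq {α β : ℝ} (hα : Real.sin (m * α) = 0) (hβ : Real.sin (n * β) = 0)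
    (hc : Real.cos (m * α) = Real.cos (n * β)) (φ : ℝ) :
    rotation α 0 ^ m = rotation β φ ^ n := by
  rw [rotation_pow, rotation_pow]
  apply ext_column <;> simp only [rotation_val, hα, hβ, hc] <;> simp

/-- The characters of the pairs of rotations by `α` and `β`, as the angle between the axes
runs through `[0, π]`. -/
def characterArc {α β : ℝ} (h : ∀ φ, rotation α 0 ^ m = rotation β φ ^ n) (t : unitInterval) :
    TorusGroup m n → ℂ :=
  chi (homOfPair (rotation α 0) (rotation β (Real.pi * t)) (h _))

theorem chi_apply {G : Type*} [Group G] (ρ : G →* SU2) (g : G) : chi ρ g = (ρ g).1.trace := rfl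

theorem chi_homOfPair_genX (A B : SU2) (h : A ^ m = B ^ n) :
    chi (homOfPair A B h) (genX m n) = A.1.trace := by
  rw [chi_apply, homOfPair_genX]

theorem chi_homOfPair_genY (A B : SU2) (h : A ^ m = B ^ n) :
    chi (homOfPair A B h) (genY m n) = B.1.trace := by
  rw [chi_apply, homOfPair_genY]

theorem chi_homOfPair_mul (A B : SU2) (h : A ^ m = B ^ n) :
    chi (homOfPair A B h) (genX m n * genY m n) = (A * B).1.trace := by
  rw [chi_apply, map_mul, homOfPair_genX, homOfPair_genY]

theorem continuous_characterArc {α β : ℝ} (h : ∀ φ, rotation α 0 ^ m = rotation β φ ^ n) :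
    Continuous (characterArc h) :=
  continuous_chi_homOfPair (A := fun _ => rotation α 0) continuous_const
    (continuous_rotation.comp (f := fun t : unitInterval => (β, Real.pi * t)) (by fun_prop))
    fun _ => h _

theorem pi_mul_mem_Icc (t : unitInterval) : Real.pi * t ∈ Icc 0 Real.pi :=
  ⟨mul_nonneg Real.pi_pos.le t.2.1, mul_le_of_le_one_right Real.pi_pos.le t.2.2⟩

theorem characterArc_injective {α β : ℝ} (h : ∀ φ, rotation α 0 ^ m = rotation β φ ^ n)
    (hα : Real.sin α ≠ 0) (hβ : Real.sin β ≠ 0) : Function.Injective (characterArc h) := by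
  intro s t hst
  have e := congrFun hst (genX m n * genY m n)
  simp only [characterArc, chi_homOfPair_mul, trace_rotation_mul] at e
  have e' : Real.cos α * Real.cos β - Real.sin α * Real.sin β * Real.cos (Real.pi * s) =
      Real.cos α * Real.cos β - Real.sin α * Real.sin β * Real.cos (Real.pi * t) := by
    exact_mod_cast mul_left_cancel₀ two_ne_zero e
  have hc := mul_left_cancel₀ (mul_ne_zero hα hβ) (sub_right_injective e')
  have := Real.injOn_cos (pi_mul_mem_Icc s) (pi_mul_mem_Icc t) hc
  exact Subtype.ext (mul_left_cancel₀ Real.pi_ne_zero this)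

theorem isEmbedding_characterArc {α β : ℝ} (h : ∀ φ, rotation α 0 ^ m = rotation β φ ^ n)
    (hα : Real.sin α ≠ 0) (hβ : Real.sin β ≠ 0) : Topology.IsEmbedding (characterArc h) :=
  ((continuous_characterArc h).isClosedEmbedding (characterArc_injective h hα hβ)).isEmbedding

theorem sin_pos_of_lt {k : ℕ} (hk : 0 < k) (hkm : k < m) : 0 < Real.sin (Real.pi * k / m) := by
  have hm : (0 : ℝ) < m := by exact_mod_cast hk.trans hkm
  have hk' : (0 : ℝ) < k := by exact_mod_cast hk
  have hlt : (k : ℝ) < m := by exact_mod_cast hkm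
  apply Real.sin_pos_of_pos_of_lt_pi
  · positivity
  · rw [div_lt_iff₀ hm]; exact mul_lt_mul_of_pos_left hlt Real.pi_pos

theorem mem_Icc_of_lt {k : ℕ} (hkm : k < m) : Real.pi * k / m ∈ Icc 0 Real.pi := by
  have hm : (0 : ℝ) < m := by exact_mod_cast (Nat.zero_le k).trans_lt hkm
  have hlt : (k : ℝ) < m := by exact_mod_cast hkm
  refine ⟨by positivity, ?_⟩
  rw [div_le_iff₀ hm]; exact mul_le_mul_of_nonneg_left hlt.le Real.pi_pos.le

theorem rotation_pow_eq_of_modEq (hm : 0 < m) (hn : 0 < n) {k k' : ℕ} (hkk : k ≡ k' [MOD 2])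
    (φ : ℝ) : rotation (Real.pi * k / m) 0 ^ m = rotation (Real.pi * k' / n) φ ^ n := by
  have hm' : (m : ℝ) ≠ 0 := by exact_mod_cast hm.ne'
  have hn' : (n : ℝ) ≠ 0 := by exact_mod_cast hn.ne'
  have e1 : (m : ℝ) * (Real.pi * k / m) = k * Real.pi := by field_simp
  have e2 : (n : ℝ) * (Real.pi * k' / n) = k' * Real.pi := by field_simp
  refine rotation_pow_eq ?_ ?_ ?_ φ
  · rw [e1, Real.sin_nat_mul_pi]
  · rw [e2, Real.sin_nat_mul_pi]
  · rw [e1, e2, Real.cos_nat_mul_pi, Real.cos_nat_mul_pi, neg_one_pow_eq_pow_mod_two, hkk,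
      ← neg_one_pow_eq_pow_mod_two]

theorem exp_pi_mul_I_mul_div (k m : ℕ) :
    exp (Real.pi * I * k / m) = exp ((Real.pi * k / m : ℝ) * I) := by
  congr 1; push_cast; ring

theorem characterArc_image_Ioo {k k' : ℕ} (hk : 0 < k) (hkm : k < m) (hk' : 0 < k')
    (hkn : k' < n)
    (h : ∀ φ, rotation (Real.pi * k / m) 0 ^ m = rotation (Real.pi * k' / n) φ ^ n) :
    characterArc h '' Ioo 0 1 = Yirr m n k k' := by
  have hα := (sin_pos_of_lt hk hkm).ne'
  have hβ := (sin_pos_of_lt hk' hkn).ne'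
  have eig : ∀ (ρ : TorusGroup m n →* SU2) (g : TorusGroup m n) (j l : ℕ),
      Module.End.HasEigenvalue (toRep ρ g) (exp (Real.pi * I * j / l)) ↔
        chi ρ g = 2 * Real.cos (Real.pi * j / l) := fun ρ g j l => by
    rw [exp_pi_mul_I_mul_div]; exact hasEigenvalue_exp_iff_trace _ _
  apply Subset.antisymm
  · rintro _ ⟨t, ht, rfl⟩
    have ht0 : (0 : ℝ) < t := ht.1
    have ht1 : (t : ℝ) < 1 := ht.2
    refine ⟨_, rfl, ?_, ?_, ?_⟩
    · rw [isIrreducible_homOfPair_rotation_iff _ _ _ _ hα hβ]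
      exact (Real.sin_pos_of_pos_of_lt_pi (mul_pos Real.pi_pos ht0)
        (mul_lt_of_lt_one_right Real.pi_pos ht1)).ne'
    · rw [eig, chi_homOfPair_genX, trace_rotation]
    · rw [eig, chi_homOfPair_genY, trace_rotation]
  · rintro _ ⟨ρ, rfl, hi, hx, hy⟩
    obtain ⟨α, β, φ, hr, hα', hβ', hφ', e, hi'⟩ := exists_chi_eq_rotation ρ
    rw [eig, e, chi_homOfPair_genX, trace_rotation] at hx
    rw [eig, e, chi_homOfPair_genY, trace_rotation] at hy
    have cx : Real.cos α = Real.cos (Real.pi * k / m) := by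
      exact_mod_cast mul_left_cancel₀ two_ne_zero hx
    have cy : Real.cos β = Real.cos (Real.pi * k' / n) := by
      exact_mod_cast mul_left_cancel₀ two_ne_zero hy
    -- Traces fix the cosines, and cos is injective on [0, π], so only φ remains; irreducibility
    -- excludes φ = 0 and φ = π.
    obtain rfl := Real.injOn_cos hα' (mem_Icc_of_lt hkm) cx
    obtain rfl := Real.injOn_cos hβ' (mem_Icc_of_lt hkn) cy
    have hs := (isIrreducible_homOfPair_rotation_iff _ _ _ _ hα hβ).1 (hi' hi)
    have h0 : φ ≠ 0 := fun h0 => hs (by rw [h0, Real.sin_zero])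
    have h1 : φ ≠ Real.pi := fun h1 => hs (by rw [h1, Real.sin_pi])
    have p0 : 0 < φ := lt_of_le_of_ne hφ'.1 h0.symm
    have p1 : φ < Real.pi := lt_of_le_of_ne hφ'.2 h1
    have d0 : 0 < φ / Real.pi := div_pos p0 Real.pi_pos
    have d1 : φ / Real.pi < 1 := (div_lt_one Real.pi_pos).2 p1
    refine ⟨⟨φ / Real.pi, d0.le, d1.le⟩, ⟨d0, d1⟩, ?_⟩
    have hφe : Real.pi * (φ / Real.pi) = φ := mul_div_cancel₀ φ Real.pi_ne_zero
    rw [e, characterArc]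
    congr 1
    simp only [hφe]

theorem closure_Ioo_unitInterval : closure (Ioo (0 : unitInterval) 1) = univ := by
  rw [closure_Ioo zero_ne_one]
  exact eq_univ_of_forall fun t => ⟨unitInterval.nonneg', unitInterval.le_one'⟩

/-- (0, 1) is dense in [0, 1], and the image of a compact space in a Hausdorff space is closed. -/
theorem range_eq_closure_image_Ioo {X : Type*} [TopologicalSpace X] [T2Space X]
    {γ : unitInterval → X} (hγ : Continuous γ) : range γ = closure (γ '' Ioo 0 1) := by
  apply Subset.antisymm
  · rw [← image_univ, ← closure_Ioo_unitInterval]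
    exact image_closure_subset_closure_image hγ
  · exact closure_minimal (image_subset_range _ _) (isCompact_range hγ).isClosed

theorem ClosureJoins.symm {X : Type*} [TopologicalSpace X] {S A B : Set X}
    (h : ClosureJoins S A B) : ClosureJoins S B A := by
  obtain ⟨γ, he, hr, hi, h0, h1⟩ := h
  refine ⟨γ ∘ unitInterval.symm, he.comp unitInterval.symmHomeomorph.isEmbedding, ?_, ?_, ?_, ?_⟩
  · rw [← hr]
    exact unitInterval.symmHomeomorph.surjective.range_comp γ
  · rw [image_comp, ← hi]
    congr 1
    ext t
    constructor
    · rintro ⟨s, ⟨hs0, hs1⟩, rfl⟩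
      exact ⟨unitInterval.symm_one ▸ unitInterval.symm_lt_symm.2 hs1,
        unitInterval.symm_zero ▸ unitInterval.symm_lt_symm.2 hs0⟩
    · rintro ⟨hs0, hs1⟩
      exact ⟨unitInterval.symm t, ⟨unitInterval.symm_one ▸ unitInterval.symm_lt_symm.2 hs1,
        unitInterval.symm_zero ▸ unitInterval.symm_lt_symm.2 hs0⟩, unitInterval.symm_symm t⟩
  · simpa using h1
  · simpa using h0

/-! ### The endpoints of the arcs -/

theorem chi_diagonal_neg {α β : ℝ} (h : rotation α 0 ^ m = rotation β 0 ^ n) :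
    ∃ h' : rotation (-α) 0 ^ m = rotation (-β) 0 ^ n,
      chi (homOfPair (rotation α 0) (rotation β 0) h) =
        chi (homOfPair (rotation (-α) 0) (rotation (-β) 0) h') := by
  obtain ⟨J, hJ⟩ := exists_conj_neg
  have h' : rotation (-α) 0 ^ m = rotation (-β) 0 ^ n := by
    rw [← hJ α, ← hJ β, conj_pow, conj_pow, h]
  refine ⟨h', ?_⟩
  rw [← chi_conj _ J]
  congr 1
  refine hom_eq_homOfPair _ _ _ h' ?_ ?_
  · exact (congrArg (fun C => J * C * J⁻¹) (homOfPair_genX _ _ h)).trans (hJ α)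
  · exact (congrArg (fun C => J * C * J⁻¹) (homOfPair_genY _ _ h)).trans (hJ β)

/-- The character of a diagonal pair lies in the reducible piece given by its angles. -/
theorem chi_diagonal_mem_Yred {α β : ℝ} (h : rotation α 0 ^ m = rotation β 0 ^ n) {i : ℕ} (N : ℤ)
    (hN : (m / m.gcd n : ℕ) * α = 2 * Real.pi / m.gcd n * i + (n / m.gcd n : ℕ) * β
      + N * (2 * Real.pi)) :
    chi (homOfPair (rotation α 0) (rotation β 0) h) ∈ Yred m n i := by
  have hx : toRep (homOfPair (rotation α 0) (rotation β 0) h) (genX m n) ![1, 0] =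
      exp (α * I) • ![1, 0] := by
    rw [toRep_apply, homOfPair_genX, rotation_zero_right_val]
    ext i; fin_cases i <;> simp [mulVec, dotProduct]
  have hy : toRep (homOfPair (rotation α 0) (rotation β 0) h) (genY m n) ![1, 0] =
      exp (β * I) • ![1, 0] := by
    rw [toRep_apply, homOfPair_genY, rotation_zero_right_val]
    ext i; fin_cases i <;> simp [mulVec, dotProduct]
  have hv : (![1, 0] : Fin 2 → ℂ) ≠ 0 := fun h0 => by simpa using congrFun h0 0
  refine ⟨_, rfl, fun hi => hv ((isIrreducible_toRep_iff _).1 hi _ _ _ hx hy), _, _, _, hv,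
    hx, hy, ?_⟩
  rw [← exp_nat_mul, ← exp_nat_mul, ← exp_nat_mul, ← exp_add, exp_eq_exp_iff_exists_int]
  refine ⟨N, ?_⟩
  have hN' := congrArg (fun x : ℝ => (x : ℂ) * I) hN
  push_cast at hN' ⊢
  linear_combination hN'

theorem closureJoins_of_lt (hm : 0 < m) (hn : 0 < n) {i₀ i₁ : ℕ} (hlt : i₀ < i₁)
    (hle : i₁ ≤ m.gcd n / 2) :
    ∃ k k' : ℕ, (k : ℤ) = (m.gcd n : ℤ) + i₀ - i₁ ∧ (k' : ℤ) = (m.gcd n : ℤ) - i₀ - i₁ ∧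
      IsIndexPair m n k k' ∧ ClosureJoins (Yirr m n k k') (Yred m n i₀) (Yred m n i₁) := by
  have hdm : m.gcd n ≤ m := Nat.gcd_le_left n hm
  have hdn : m.gcd n ≤ n := Nat.gcd_le_right m hn
  have hdpos : 0 < m.gcd n := Nat.gcd_pos_of_pos_left n hm
  obtain ⟨a, ha⟩ := Nat.gcd_dvd_left m n
  obtain ⟨b, hb⟩ := Nat.gcd_dvd_right m n
  set d := m.gcd n with hd
  obtain ⟨k, hk⟩ : ∃ k : ℕ, k + i₁ = d + i₀ := ⟨d + i₀ - i₁, by omega⟩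
  -- Positivity of k' uses i₀ < i₁ ≤ d/2, which gives i₀ + i₁ < d.
  obtain ⟨k', hk'⟩ : ∃ k' : ℕ, k' + i₀ + i₁ = d := ⟨d - i₀ - i₁, by omega⟩
  have hkk : k ≡ k' [MOD 2] := by unfold Nat.ModEq; omega
  have hk0 : 0 < k := by omega
  have hk0' : 0 < k' := by omega
  have hkm : k < m := by omega
  have hkn : k' < n := by omega
  have hr := rotation_pow_eq_of_modEq hm hn hkk
  have hα := (sin_pos_of_lt hk0 hkm).ne'
  have hβ := (sin_pos_of_lt hk0' hkn).ne'
  have hdR : (d : ℝ) ≠ 0 := by exact_mod_cast hdpos.ne'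
  have hmR : (m : ℝ) ≠ 0 := by exact_mod_cast hm.ne'
  have hnR : (n : ℝ) ≠ 0 := by exact_mod_cast hn.ne'
  have hda : m / d = a := Nat.div_eq_of_eq_mul_right hdpos ha
  have hdb : n / d = b := Nat.div_eq_of_eq_mul_right hdpos hb
  have haR : (m : ℝ) = d * a := by exact_mod_cast ha
  have hbR : (n : ℝ) = d * b := by exact_mod_cast hb
  have hxa : (a : ℝ) * (Real.pi * k / m) = Real.pi * k / d := by
    rw [eq_div_iff hdR, ← mul_div_assoc, div_mul_eq_mul_div, div_eq_iff hmR, haR]; ring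
  have hyb : (b : ℝ) * (Real.pi * k' / n) = Real.pi * k' / d := by
    rw [eq_div_iff hdR, ← mul_div_assoc, div_mul_eq_mul_div, div_eq_iff hnR, hbR]; ring
  have hkR : (k : ℝ) = d + i₀ - i₁ := by
    have : (k + i₁ : ℝ) = d + i₀ := by exact_mod_cast hk
    linarith
  have hkR' : (k' : ℝ) = d - i₀ - i₁ := by
    have : (k' + i₀ + i₁ : ℝ) = d := by exact_mod_cast hk'
    linarith
  refine ⟨k, k', by omega, by omega, ⟨hk0, hkm, hk0', hkn, hkk⟩, characterArc hr,
    isEmbedding_characterArc hr hα hβ, ?_, characterArc_image_Ioo hk0 hkm hk0' hkn hr, ?_, ?_⟩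
  · rw [← characterArc_image_Ioo hk0 hkm hk0' hkn hr]
    exact range_eq_closure_image_Ioo (continuous_characterArc hr)
  · have : characterArc hr 0 = chi (homOfPair _ _ (hr 0)) := by
      unfold characterArc
      congr 1
      simp
    rw [this]
    -- Here k - k' = 2i₀ exactly, so no multiple of 2π is needed.
    refine chi_diagonal_mem_Yred _ 0 ?_
    rw [← hd, hda, hdb, hxa, hyb, hkR, hkR']
    field_simp
    push_cast
    ring
  · have h1 : rotation (Real.pi * k / m) 0 ^ m = rotation (-(Real.pi * k' / n)) 0 ^ n := by
      rw [← rotation_pi]; exact hr _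
    have : characterArc hr 1 = chi (homOfPair _ _ h1) := by
      unfold characterArc
      congr 1
      simp [rotation_pi]
    rw [this]
    obtain ⟨h2, e2⟩ := chi_diagonal_neg h1
    rw [e2]
    -- After both angles change sign, k + k' = 2d - 2i₁ gives -πk/d = 2πi₁/d + πk'/d - 2π, hence the
    -- -1.
    refine chi_diagonal_mem_Yred h2 (-1) ?_
    rw [← hd, hda, hdb, neg_neg, mul_neg, hxa, hyb, hkR, hkR']
    field_simp
    push_cast
    ring

/-! ### Path-connectedness of `Y` -/

theorem joinedIn_Y_of_path {A B : ℝ → SU2} (hA : Continuous A) (hB : Continuous B)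
    (h : ∀ t, A t ^ m = B t ^ n) :
    JoinedIn (Y m n) (chi (homOfPair (A 0) (B 0) (h 0))) (chi (homOfPair (A 1) (B 1) (h 1))) := by
  refine JoinedIn.ofLine (continuous_chi_homOfPair hA hB h).continuousOn rfl rfl ?_
  rintro _ ⟨t, -, rfl⟩
  exact ⟨_, rfl⟩

/-- When y^n is ±1 it does not depend on the axis of y, so the axis can turn freely. -/
theorem joinedIn_Y_of_pow_central {α β φ ψ : ℝ} (hβ : Real.sin (n * β) = 0)
    (h : rotation α 0 ^ m = rotation β φ ^ n)
    (h' : rotation α 0 ^ m = rotation β ψ ^ n) :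
    JoinedIn (Y m n) (chi (homOfPair _ _ h)) (chi (homOfPair _ _ h')) := by
  have H : ∀ t, rotation α 0 ^ m = rotation β (φ + t * (ψ - φ)) ^ n := fun t => by
    rw [h, rotation_pow, rotation_pow, rotation_eq_of_sin_eq_zero hβ]
  convert joinedIn_Y_of_path (A := fun _ => rotation α 0) continuous_const
    (continuous_rotation.comp (f := fun t : ℝ => (β, φ + t * (ψ - φ))) (by fun_prop)) H using 3
  · simp
  · simp

theorem rotation_pow_eq_of_congr {α β : ℝ} {N : ℤ} (h : m * α = n * β + N * (2 * Real.pi)) :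
    rotation α 0 ^ m = rotation β 0 ^ n := by
  rw [rotation_pow, rotation_pow, h, rotation_add_two_pi]

theorem joinedIn_Y_of_congr {α β α' β' : ℝ} {N : ℤ} (h : m * α = n * β + N * (2 * Real.pi))
    (h' : m * α' = n * β' + N * (2 * Real.pi)) :
    JoinedIn (Y m n) (chi (homOfPair _ _ (rotation_pow_eq_of_congr h)))
      (chi (homOfPair _ _ (rotation_pow_eq_of_congr h'))) := by
  have H : ∀ t : ℝ, rotation (α + t * (α' - α)) 0 ^ m = rotation (β + t * (β' - β)) 0 ^ n :=
    fun t => rotation_pow_eq_of_congr (N := N) (by linear_combination (1 - t) * h + t * h')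
  convert joinedIn_Y_of_path
    (continuous_rotation.comp (f := fun t : ℝ => (α + t * (α' - α), 0)) (by fun_prop))
    (continuous_rotation.comp (f := fun t : ℝ => (β + t * (β' - β), 0)) (by fun_prop)) H using 3
  all_goals simp

theorem exists_congr_of_rotation_eq {α β : ℝ} (h : rotation α 0 = rotation β 0) :
    ∃ N : ℤ, α = β + N * (2 * Real.pi) := by
  have h0 := congrArg (fun A : SU2 => A.1 0 0) h
  simp only [rotation_zero_right_val, of_apply, cons_val_zero] at h0
  obtain ⟨N, hN⟩ := exp_eq_exp_iff_exists_int.1 h0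
  refine ⟨N, ?_⟩
  have : (α : ℂ) * I = (β + N * (2 * Real.pi)) * I := by rw [hN]; ring
  exact_mod_cast mul_right_cancel₀ I_ne_zero this

theorem joinedIn_Y_diagonal_one (hm : 0 < m) (hn : 0 < n) {α β : ℝ}
    (h : rotation α 0 ^ m = rotation β 0 ^ n) :
    JoinedIn (Y m n) (chi (homOfPair _ _ h)) (chi (homOfPair (1 : SU2) 1 (by simp))) := by
  have hm' : (m : ℝ) ≠ 0 := by exact_mod_cast hm.ne'
  have hn' : (n : ℝ) ≠ 0 := by exact_mod_cast hn.ne'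
  have h' := h
  rw [rotation_pow, rotation_pow] at h'
  obtain ⟨N, hN⟩ := exists_congr_of_rotation_eq h'
  have e1 : (m : ℝ) * (Real.pi * N / m) = N * Real.pi := by field_simp
  have e2 : (n : ℝ) * (Real.pi * N / n) = N * Real.pi := by field_simp
  have e3 : (n : ℝ) * -(Real.pi * N / n) = -(N * Real.pi) := by rw [mul_neg, e2]
  have c1 : m * (Real.pi * N / m) = n * -(Real.pi * N / n) + N * (2 * Real.pi) := by
    rw [e1, e3]; ring
  have c2 : m * (Real.pi * N / m) = n * (Real.pi * N / n) + (0 : ℤ) * (2 * Real.pi) := by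
    rw [e1, e2]; simp
  have c3 : (m : ℝ) * 0 = n * 0 + (0 : ℤ) * (2 * Real.pi) := by simp
  have s2 : Real.sin (n * (Real.pi * N / n)) = 0 := by rw [e2, Real.sin_int_mul_pi]
  have hπ : rotation (Real.pi * N / m) 0 ^ m = rotation (Real.pi * N / n) Real.pi ^ n := by
    rw [rotation_pi]; exact rotation_pow_eq_of_congr c1
  have j1 := joinedIn_Y_of_congr hN c1
  have j2 := joinedIn_Y_of_pow_central s2 hπ (rotation_pow_eq_of_congr c2)
  have j3 := joinedIn_Y_of_congr c2 c3
  simp only [rotation_pi] at j2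
  simp only [rotation_zero] at j3
  exact (j1.trans j2).trans j3

theorem joinedIn_Y_one (hm : 0 < m) (hn : 0 < n) (ρ : TorusGroup m n →* SU2) :
    JoinedIn (Y m n) (chi ρ) (chi (homOfPair (1 : SU2) 1 (by simp))) := by
  obtain ⟨α, β, φ, h, -, -, -, e, -⟩ := exists_chi_eq_rotation ρ
  rw [e]
  have h' := h
  rw [rotation_pow, rotation_pow] at h'
  have h10 := congrArg (fun A : SU2 => A.1 1 0) h'
  simp only [rotation_val, of_apply, cons_val_zero, cons_val_one, Real.sin_zero, ofReal_zero,
    mul_zero] at h10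
  -- The lower-left entry of the relation: either y^n is central, or y itself is diagonal.
  have hs : Real.sin (n * β) * Real.sin φ = 0 := by
    have := (mul_eq_zero.1 h10.symm).resolve_left I_ne_zero
    exact_mod_cast this
  rcases mul_eq_zero.1 hs with hβ | hφ
  · have h0 : rotation α 0 ^ m = rotation β 0 ^ n := by
      rw [h, rotation_pow, rotation_pow, rotation_eq_of_sin_eq_zero hβ]
    exact (joinedIn_Y_of_pow_central hβ h h0).trans (joinedIn_Y_diagonal_one hm hn h0)
  · obtain ⟨γ, hγ⟩ : ∃ γ, rotation β φ = rotation γ 0 :=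
      ⟨_, eq_rotation_of_diagonal (by rw [rotation_val, hφ]; simp)⟩
    simp only [hγ]
    exact joinedIn_Y_diagonal_one hm hn _

theorem isPathConnected_Y (hm : 0 < m) (hn : 0 < n) : IsPathConnected (Y m n) := by
  refine ⟨chi (homOfPair (1 : SU2) 1 (by simp)), ⟨_, rfl⟩, ?_⟩
  rintro _ ⟨ρ, rfl⟩
  exact (joinedIn_Y_one hm hn ρ).symm

end TorusChar

end

theorem corollary12 (m n : ℕ) (hm : 0 < m) (hn : 0 < n) :
    (∀ i₀ i₁ : ℕ, i₀ ≤ m.gcd n / 2 → i₁ ≤ m.gcd n / 2 → i₀ ≠ i₁ →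
      ∃ k k' : ℕ, TorusChar.IsIndexPair m n k k' ∧
        TorusChar.ClosureJoins (TorusChar.Yirr m n k k')
          (TorusChar.Yred m n i₀) (TorusChar.Yred m n i₁)) ∧
    (∀ i₀ i₁ : ℕ, i₀ < i₁ → i₁ ≤ m.gcd n / 2 →
      ∃ k k' : ℕ, (k : ℤ) = (m.gcd n : ℤ) + i₀ - i₁ ∧ (k' : ℤ) = (m.gcd n : ℤ) - i₀ - i₁ ∧
        TorusChar.IsIndexPair m n k k' ∧
        TorusChar.ClosureJoins (TorusChar.Yirr m n k k')
          (TorusChar.Yred m n i₀) (TorusChar.Yred m n i₁)) ∧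
    IsConnected (TorusChar.Y m n) := by
  refine ⟨fun i₀ i₁ h₀ h₁ hne => ?_,
    fun i₀ i₁ hlt hle => TorusChar.closureJoins_of_lt hm hn hlt hle,
    (TorusChar.isPathConnected_Y hm hn).isConnected⟩
  rcases lt_or_gt_of_ne hne with hlt | hlt
  · obtain ⟨k, k', -, -, hp, hj⟩ := TorusChar.closureJoins_of_lt hm hn hlt h₁
    exact ⟨k, k', hp, hj⟩
  · obtain ⟨k, k', -, -, hp, hj⟩ := TorusChar.closureJoins_of_lt hm hn hlt h₀
    exact ⟨k, k', hp, hj.symm⟩
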